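/- Let $n\ge 3$. Let $G=\widehat{\mathrm{Zig}}_n$ be the contracted zigzag graph: its vertices are $1,\dots,n$, and its directed edges are the slack edges $x_k:k\to k+1$ $(1\le k\le n-1)$ and the nonslack edges $y_0:1\to 2$, $y_k:k\to k+2$ $(1\le k\le n-2)$ and $y_{n-1}:n-1\to n$. A *route* is a directed path from $1$ to $n$; a prefix (suffix) at $i$ is a path from $1$ to $i$ (from $i$ to $n$). At each inner vertex $i$ $(2\le i\le n-1)$ the incoming edges are ordered $y_{i-2}\prec x_{i-1}$ and the outgoing edges $x_i\prec y_i$ (the length-reverse-length framing). Two prefixes at $i$ are ordered by the edges along which they enter the last vertex at which they come together, and two suffixes at $i$ by the edges along which they leave the first vertex at which they diverge. Two routes are *coherent* if there is no common inner vertex $i$ at which they have the form $PQ$ and $P'Q'$, with $P,P'$ prefixes at $i$ and $Q,Q'$ suffixes at $i$, such that $P\prec P'$ and $Q'\prec Q$, or $P'\prec P$ and $Q\prec Q'$. For each maximal set $C$ of pairwise coherent routes let $\Delta_C\subset\mathbb{R}^{E(G)}$ be the convex hull of the indicator vectors of the routes in $C$. The simplices $\Delta_C$ form the triangulation $\mathcal{T}_n^{LRL}$;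 two different simplices are *adjacent* if they share a codimension-one face, i.e. their vertex sets differ in exactly one vertex. Let $\mathcal{F}_n^{\mathbb{Z}}$ be the set of nonnegative integer flows $\phi$ on $G$ with net flow vector $(0,1,\dots,1,-(n-2))$. The simplex $\Delta_C$ *corresponds* to the flow $\phi$ with $\phi(e)=0$ for the edges $e$ leaving vertex $1$ and, for an edge $e$ leaving an inner vertex $i$, $\phi(e)=\#\{P : P \text{ is a prefix at } i \text{ and some route in } C \text{ begins with } P \text{ followed by } e\}-1$. Let $2\le i\le n-1$ and $\phi\in\mathcal{F}_n^{\mathbb{Z}}$ with $\phi(x_i)>0$ and $\phi(y_{i+1})>0$, i.e. the elementary move $m_i^+$ applies to $\phi$, and let $\phi'=m_i^+(\phi)$ be obtained from $\phi$ by subtracting $1$ from $\phi(x_i)$ and $\phi(y_{i+1})$ and adding $1$ to $\phi(x_{i+2})$ and $\phi(y_i)$ (conditions and operations on edges that do not exist are ignored). Define the sequence of offsets $\mathbf{z}^{(i)}(\phi)=(z_{i+1},\dots,z_{n-1})$, empty for $i=n-1$, by $z_{i+1}=\phi(y_{i+1})$ and, as long as entries are missing and $z_j$ is the last entry defined so far: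 if $z_j<0$, then $z_{j+1}=z_j+\phi(y_{j+1})$; if $z_j>0$, then $z_{j+1}=\varnothing$ and, if $j<n-2$, $z_{j+2}=z_j-\phi(x_{j+2})$; if $z_j=0$, then $z_k=0$ for all $k\ge j$. Then there is exactly one simplex of $\mathcal{T}_n^{LRL}$ corresponding to $\phi$ and exactly one corresponding to $\phi'$, and these two simplices are adjacent if and only if the sequence of offsets $\mathbf{z}^{(i)}(\phi)$ contains no zeroes. -/

import Mathlib

namespace ZigZag

/-! ### The contracted zigzag graph on the vertices `1, …, n` -/

/-- Labels of edges: `x k` are the slack edges, `y k` the nonslack edges. -/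
inductive Edge : Type
  | x (k : ℕ) : Edge
  | y (k : ℕ) : Edge
  deriving DecidableEq

/-- Tail of an edge: `x k` starts at `k`, `y k` starts at `k`, except that `y 0` starts at `1`. -/
def Edge.src : Edge → ℕ
  | .x k => k
  | .y k => max 1 k

/-- Head of an edge: `x k` ends at `k + 1`, `y k` ends at `k + 2`, except that `y (n - 1)` ends
at `n`. -/
def Edge.tgt (n : ℕ) : Edge → ℕ
  | .x k => k + 1
  | .y k => min (k + 2) n

/-- The edge set of the contracted zigzag graph: `x 1, …, x (n - 1)` and `y 0, …, y (n - 1)`. -/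
def edges (n : ℕ) : Finset Edge :=
  (Finset.Icc 1 (n - 1)).image Edge.x ∪ (Finset.range n).image Edge.y

/-- Inner vertices `2, …, n - 1`. -/
def IsInner (n i : ℕ) : Prop := 2 ≤ i ∧ i ≤ n - 1

/-- `IsPath n a b p`: the list of edges `p` is a directed path from vertex `a` to vertex `b`. -/
def IsPath (n : ℕ) : ℕ → ℕ → List Edge → Prop
  | a, b, [] => a = b
  | a, b, e :: p => e ∈ edges n ∧ e.src = a ∧ IsPath n (e.tgt n) b p

/-- A route is a path from `1` to `n`. -/
def IsRoute (n : ℕ) (R : List Edge) : Prop := IsPath n 1 n R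

/-! ### The length-reverse-length framing, coherence and maximal cliques -/

/-- The order on the incoming edges `y (j - 2)`, `x (j - 1)` of the inner vertex `j`:
nonslack before slack. -/
def InLT (n j : ℕ) (e e' : Edge) : Prop :=
  IsInner n j ∧ e = .y (j - 2) ∧ e' = .x (j - 1)

/-- The order on the outgoing edges `x k`, `y k` of the inner vertex `k`: slack before nonslack. -/
def OutLT (n k : ℕ) (e e' : Edge) : Prop :=
  IsInner n k ∧ e = .x k ∧ e' = .y k

/-- The order on prefixes: `P` and `P'` agree after some vertex `j`, which they enter along
different edges `e`, `e'`, and `e` precedes `e'`. -/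
def PrefixLT (n : ℕ) (P P' : List Edge) : Prop :=
  ∃ (j : ℕ) (A A' S : List Edge) (e e' : Edge),
    P = A ++ e :: S ∧ P' = A' ++ e' :: S ∧ InLT n j e e'

/-- The order on suffixes: `Q` and `Q'` agree up to some vertex `k`, which they leave along
different edges `e`, `e'`, and `e` precedes `e'`. -/
def SuffixLT (n : ℕ) (Q Q' : List Edge) : Prop :=
  ∃ (k : ℕ) (S A A' : List Edge) (e e' : Edge),
    Q = S ++ e :: A ∧ Q' = S ++ e' :: A' ∧ OutLT n k e e'

/-- `R` and `R'` cross at a common inner vertex `i`: the prefix of `R` at `i` precedes that of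
`R'`, while the suffix of `R'` at `i` precedes that of `R`. -/
def Cross (n : ℕ) (R R' : List Edge) : Prop :=
  ∃ (i : ℕ) (P Q P' Q' : List Edge), IsInner n i ∧
    IsPath n 1 i P ∧ IsPath n i n Q ∧ IsPath n 1 i P' ∧ IsPath n i n Q' ∧
    R = P ++ Q ∧ R' = P' ++ Q' ∧ PrefixLT n P P' ∧ SuffixLT n Q' Q

/-- Two routes are coherent if they do not cross, in either order, at a common inner vertex. -/
def Coherent (n : ℕ) (R R' : List Edge) : Prop := ¬ Cross n R R' ∧ ¬ Cross n R' R

/-- A clique is a set of pairwise coherent routes. -/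
def IsClique (n : ℕ) (C : Set (List Edge)) : Prop :=
  (∀ R ∈ C, IsRoute n R) ∧ ∀ R ∈ C, ∀ R' ∈ C, Coherent n R R'

/-- A maximal clique is an inclusion-maximal set of pairwise coherent routes. -/
def IsMaxClique (n : ℕ) (C : Set (List Edge)) : Prop := Maximal (IsClique n) C

/-! ### The triangulation of the flow polytope and its dual graph -/

/-- The unit flow along a route, as a point of the flow polytope. -/
noncomputable def routeVec (R : List Edge) : Edge → ℝ := fun e => if e ∈ R then 1 else 0

/-- The simplex spanned by the routes of a clique. -/
noncomputable def simplexOf (C : Set (List Edge)) : Set (Edge → ℝ) :=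
  convexHull ℝ (routeVec '' C)

/-- The triangulation: the set of simplices spanned by the maximal cliques. -/
def triangulation (n : ℕ) : Set (Set (Edge → ℝ)) :=
  {Δ | ∃ C, IsMaxClique n C ∧ Δ = simplexOf C}

/-- The codimension one faces of a simplex: the hulls of all vertices but one. -/
def IsFacet (F Δ : Set (Edge → ℝ)) : Prop :=
  ∃ v ∈ Δ.extremePoints ℝ, F = convexHull ℝ (Δ.extremePoints ℝ \ {v})

/-- The dual graph: two different simplices of the triangulation are adjacent if they share a
codimension one face. -/
def dualGraph (n : ℕ) : SimpleGraph (triangulation n) where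
  Adj Δ Δ' := Δ ≠ Δ' ∧ ∃ F, IsFacet F Δ.1 ∧ IsFacet F Δ'.1
  symm := ⟨fun _ _ ⟨h, F, h₁, h₂⟩ => ⟨h.symm, F, h₂, h₁⟩⟩
  loopless := ⟨fun _ h => h.1 rfl⟩

/-! ### Integer flows, and the integer flow of a maximal clique -/

/-- The net flow vector `(0, 1, …, 1, -(n - 2))`. -/
def netFlow (n v : ℕ) : ℤ := if v = 1 then 0 else if v = n then -((n : ℤ) - 2) else 1

/-- Nonnegative integer flows with net flow `netFlow n`; a flow on the edge set `edges n` is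
extended by zero to all edge labels. -/
def integerFlows (n : ℕ) : Set (Edge → ℤ) :=
  {φ | (∀ e, 0 ≤ φ e) ∧ (∀ e, e ∉ edges n → φ e = 0) ∧
    ∀ v, 1 ≤ v → v ≤ n →
      (∑ e ∈ edges n with e.tgt n = v, φ e) + netFlow n v = ∑ e ∈ edges n with e.src = v, φ e}

/-- The edges of the bipartite tree that a clique `C` induces at the vertex `i`: a prefix `P` at
`i` is joined to an outgoing edge `e` of `i` if some route of `C` starts with `P` followed
by `e`. -/
def treeEdges (n : ℕ) (C : Set (List Edge)) (i : ℕ) : Set (List Edge × Edge) :=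
  {p | p.2 ∈ edges n ∧ p.2.src = i ∧ ∃ R ∈ C, ∃ Q, R = p.1 ++ p.2 :: Q}

/-- The integer flow of a clique: zero on the edges leaving vertex `1`; on an edge `e` leaving an
inner vertex, the degree of `e` in the bipartite tree at that vertex, minus one. -/
noncomputable def flowOf (n : ℕ) (C : Set (List Edge)) (e : Edge) : ℤ :=
  if e ∈ edges n ∧ 2 ≤ e.src then
    ({P | (P, e) ∈ treeEdges n C e.src}.ncard : ℤ) - 1
  else 0

/-- A simplex of the triangulation corresponds to the flow `φ` if it is spanned by a maximal
clique whose integer flow is `φ`. -/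
def Corresponds (n : ℕ) (Δ : triangulation n) (φ : Edge → ℤ) : Prop :=
  ∃ C, IsMaxClique n C ∧ Δ.1 = simplexOf C ∧ flowOf n C = φ

/-! ### Elementary moves and offsets -/

/-- The move `m_i^+` applies to `φ`: `φ (x i) > 0` and `φ (y (i + 1)) > 0`, the second condition
being ignored if there is no edge `y (i + 1)`. -/
def MoveApplies (n i : ℕ) (φ : Edge → ℤ) : Prop :=
  0 < φ (.x i) ∧ (.y (i + 1) ∈ edges n → 0 < φ (.y (i + 1)))

/-- The result of `m_i^+`: subtract one on `x i` and `y (i + 1)`, add one on `x (i + 2)` and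
`y i`, ignoring those that are not edges of the graph. -/
def move (n i : ℕ) (φ : Edge → ℤ) (e : Edge) : ℤ :=
  if e ∈ edges n then
    if e = .x i ∨ e = .y (i + 1) then φ e - 1
    else if e = .x (i + 2) ∨ e = .y i then φ e + 1
    else φ e
  else φ e

/-- `offsetsFrom φ m j z` is the list of the `m` offsets with indices `j, …, j + m - 1`, where the
first is the integer `z`; `none` stands for the value `∅`. -/
def offsetsFrom (φ : Edge → ℤ) : ℕ → ℕ → ℤ → List (Option ℤ)
  | 0, _, _ => []
  | 1, _, z => [some z]
  | m + 2, j, z =>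
    if z = 0 then List.replicate (m + 2) (some 0)
    else if z < 0 then some z :: offsetsFrom φ (m + 1) (j + 1) (z + φ (.y (j + 1)))
    else some z :: none :: offsetsFrom φ m (j + 2) (z - φ (.x (j + 2)))

/-- The sequence of offsets `(z_{i+1}, …, z_{n-1})` of `φ` at the inner vertex `i`, starting with
`z_{i+1} = φ (y (i + 1))`. -/
def offsets (n i : ℕ) (φ : Edge → ℤ) : List (Option ℤ) :=
  offsetsFrom φ (n - 1 - i) (i + 1) (φ (.y (i + 1)))

end ZigZag

/-! Write `a k` and `b k` for the values of a flow on `x k` and `y k`. Conservation says that `a k +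
b k + 1` satisfies the same recursion as the number of prefixes at `k` in the clique built as
follows. The prefixes at `k` are kept in increasing order; the first `a k + 1` continue along `x k`,
the last `b k + 1` along `y k`, and exactly one, the pivot of index `a k`, continues along both. The
list at `j + 2` is then the extensions by `y j` followed by those by `x (j + 1)`.

The routes obtained are coherent, since slack continuations weakly precede nonslack ones
(`IsBalanced.not_cross`). They form a maximal clique, since any other continuation of a listed
prefix crosses a route through the pivot (`IsBalanced.isMaxClique`). A maximal clique with the same
flow has equally many continuations of both kinds at each vertex, and coherence leaves only one
position for them (`IsFlowOf.eq_routes`). So each flow has exactly one simplex. Route vectors are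
0/1 vectors, hence all are vertices of the simplices, and adjacency means that the cliques differ by
the exchange of one route (`dualGraph_adj_iff`).

The move at `i` shifts the pivot at `i` from `q` to its predecessor `q'`. This removes `q x_i` from
the end of the list at `i + 1` and adds `q' y_i` at the front of the list at `i + 2`; the lists at
`i + 3` then differ in one entry, with `q x_i y_{i+1}` replaced by `q' y_i x_{i+2}`. An offset is
the index of the differing entry minus that of the pivot. A negative offset sends the difference
along the slack edge only, a positive one along the nonslack edge only. If zero never occurs, a
single route is exchanged at the end. At zero the old pivot itself disappears, and with it at least
two routes, one along each outgoing edge, so the simplices are not adjacent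
(`IsBalanced.isExchange_or_pivot`). -/

namespace ZigZag

/-! ### Paths -/

theorem isPath_append {n : ℕ} {p q : List Edge} {a c : ℕ} :
    IsPath n a c (p ++ q) ↔ ∃ b, IsPath n a b p ∧ IsPath n b c q := by
  induction p generalizing a with
  | nil => simp [IsPath]
  | cons e p ih => simp [IsPath, ih, and_assoc]

theorem x_mem_edges {n k : ℕ} : Edge.x k ∈ edges n ↔ 1 ≤ k ∧ k ≤ n - 1 := by
  simp [edges]

theorem y_mem_edges {n k : ℕ} : Edge.y k ∈ edges n ↔ k < n := by
  simp [edges]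

theorem Edge.src_lt_tgt {n : ℕ} {e : Edge} (hn : 3 ≤ n) (he : e ∈ edges n) :
    e.src < e.tgt n := by
  cases e with
  | x k => simp [Edge.src, Edge.tgt]
  | y k => rw [y_mem_edges] at he; simp only [Edge.src, Edge.tgt]; omega

theorem Edge.one_le_src {n : ℕ} {e : Edge} (he : e ∈ edges n) : 1 ≤ e.src := by
  cases e with
  | x k => exact (x_mem_edges.1 he).1
  | y k => simp [Edge.src]

theorem IsPath.src_le_of_mem {n : ℕ} (hn : 3 ≤ n) {p : List Edge} {a b : ℕ}
    (h : IsPath n a b p) : ∀ e ∈ p, a ≤ e.src := by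
  induction p generalizing a with
  | nil => simp
  | cons e p ih =>
    obtain ⟨he, hs, hp⟩ := h
    intro f hf
    rcases List.mem_cons.1 hf with rfl | hf
    · exact hs.ge
    · have := ih hp f hf
      have := Edge.src_lt_tgt hn he
      omega

theorem IsPath.pairwise_src_lt {n : ℕ} (hn : 3 ≤ n) {p : List Edge} {a b : ℕ}
    (h : IsPath n a b p) : p.Pairwise (fun e f => e.src < f.src) := by
  induction p generalizing a with
  | nil => simp
  | cons e p ih =>
    obtain ⟨he, hs, hp⟩ := h
    refine List.pairwise_cons.2 ⟨fun f hf => ?_, ih hp⟩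
    have := hp.src_le_of_mem hn f hf
    have := Edge.src_lt_tgt hn he
    omega

theorem IsPath.eq_nil {n : ℕ} (hn : 3 ≤ n) {p : List Edge} {a : ℕ} (h : IsPath n a a p) :
    p = [] := by
  have le : ∀ (p : List Edge) (a b : ℕ), IsPath n a b p → a ≤ b := by
    intro p
    induction p with
    | nil => intro a b h; exact h.le
    | cons e p ih =>
      rintro a b ⟨he, hs, hp⟩
      have := ih _ _ hp
      have := Edge.src_lt_tgt hn he
      omega
  cases p with
  | nil => rfl
  | cons e p =>
    obtain ⟨he, hs, hp⟩ := h
    have := le _ _ _ hp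
    have := Edge.src_lt_tgt hn he
    omega

theorem isPath_append_singleton {n : ℕ} {p : List Edge} {e : Edge} {a c : ℕ} :
    IsPath n a c (p ++ [e]) ↔ e ∈ edges n ∧ IsPath n a e.src p ∧ e.tgt n = c := by
  rw [isPath_append]
  simp only [IsPath]
  constructor
  · rintro ⟨b, h, he, rfl, h'⟩
    exact ⟨he, h, h'⟩
  · rintro ⟨he, h, h'⟩
    exact ⟨_, h, he, rfl, h'⟩

theorem IsRoute.isPath_src {n : ℕ} {P Q : List Edge} {e : Edge} (h : IsRoute n (P ++ e :: Q)) :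
    e ∈ edges n ∧ IsPath n 1 e.src P ∧ IsPath n e.src n (e :: Q) := by
  obtain ⟨b, h, he, rfl, h'⟩ := isPath_append.1 h
  exact ⟨he, h, he, rfl, h'⟩

/-- Tails strictly increase along a path, so a route is its edge set sorted by tail. This is what
makes `routeVec` injective on routes. -/
theorem IsRoute.eq_of_mem_iff {n : ℕ} (hn : 3 ≤ n) {R R' : List Edge} (h : IsRoute n R)
    (h' : IsRoute n R') (hm : ∀ e, e ∈ R ↔ e ∈ R') : R = R' := by
  have s := IsPath.pairwise_src_lt hn h
  have s' := IsPath.pairwise_src_lt hn h'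
  have nd : ∀ {l : List Edge}, l.Pairwise (fun e f => e.src < f.src) → l.Nodup := fun hl =>
    hl.imp (fun hab hEq => by subst hEq; exact lt_irrefl _ hab)
  refine List.Perm.eq_of_pairwise ?_ s s' ((List.perm_ext_iff_of_nodup (nd s) (nd s')).2 hm)
  intro a b _ _ hab hba
  omega

/-! ### The order on prefixes -/

theorem PrefixLT.append {n : ℕ} {P P' : List Edge} (h : PrefixLT n P P') (S : List Edge) :
    PrefixLT n (P ++ S) (P' ++ S) := by
  obtain ⟨j, A, A', T, e, e', rfl, rfl, h⟩ := h
  exact ⟨j, A, A', T ++ S, e, e', by simp, by simp, h⟩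

/-- Compare the common tails of the two decompositions. If one is shorter, both edges preceding it
belong to the longer common tail and must coincide; if the lengths agree, a slack edge would equal a
nonslack one. -/
theorem PrefixLT.asymm {n : ℕ} {P P' : List Edge} (h : PrefixLT n P P') : ¬ PrefixLT n P' P := by
  have key : ∀ (A A' D D' S U : List Edge) (e e' f f' : Edge), e ≠ e' → S.length < U.length →
      A ++ e :: S = D' ++ f' :: U → A' ++ e' :: S = D ++ f :: U → False := by
    intro A A' D D' S U e e' f f' hne hlt h₁ h₂
    have s₁ : e :: S <:+ U :=
      List.suffix_of_suffix_length_le (l₃ := A ++ e :: S) ⟨A, rfl⟩ ⟨D' ++ [f'], by simp [h₁]⟩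
        (by simpa using hlt)
    have s₂ : e' :: S <:+ U :=
      List.suffix_of_suffix_length_le (l₃ := A' ++ e' :: S) ⟨A', rfl⟩ ⟨D ++ [f], by simp [h₂]⟩
        (by simpa using hlt)
    have s := (List.suffix_of_suffix_length_le s₁ s₂ (by simp)).eq_of_length (by simp)
    exact hne (List.cons.inj s).1
  obtain ⟨j, A, A', S, e, e', rfl, rfl, -, rfl, rfl⟩ := h
  rintro ⟨k, D, D', U, f, f', h₁, h₂, -, rfl, rfl⟩
  rcases lt_trichotomy S.length U.length with hl | hl | hl
  · exact key A A' D D' S U _ _ _ _ (by simp) hl h₂ h₁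
  · have := (List.append_inj' h₂ (by simp [hl])).2
    simp at this
  · exact key D' D A' A U S _ _ _ _ (by simp) hl h₂.symm h₁.symm

/-! ### Coherent prefixes of a flow with slack values `a` -/

/-- The prefixes at each vertex, in increasing order, of the clique whose flow takes the value
`a k` on `x k`. The list at the auxiliary vertex `0` produces the edge `y 0`. -/
def prefixes (a : ℕ → ℕ) : ℕ → List (List Edge)
  | 0 => [[]]
  | 1 => [[]]
  | j + 2 => ((prefixes a j).drop (a j)).map (· ++ [Edge.y j]) ++
      ((prefixes a (j + 1)).take (a (j + 1) + 1)).map (· ++ [Edge.x (j + 1)])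

/-- The prefixes that continue along a given edge. -/
def continuing (a : ℕ → ℕ) : Edge → List (List Edge)
  | .x k => (prefixes a k).take (a k + 1)
  | .y k => (prefixes a k).drop (a k)

/-- The prefixes that end with a given edge. -/
def extended (a : ℕ → ℕ) (e : Edge) : List (List Edge) := (continuing a e).map (· ++ [e])

/-- The routes of the clique. -/
def routes (n : ℕ) (a : ℕ → ℕ) : List (List Edge) :=
  prefixes a n ++ extended a (.y (n - 1))

/-- `a` and `b` are the values on slack and nonslack edges of an integer flow. -/
structure IsBalanced (n : ℕ) (a b : ℕ → ℕ) : Prop where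
  a_zero : a 0 = 0
  a_one : a 1 = 0
  b_zero : b 0 = 0
  b_one : b 1 = 0
  step : ∀ j, j + 3 ≤ n → a (j + 2) + b (j + 2) = b j + a (j + 1) + 1

theorem prefixes_add_two (a : ℕ → ℕ) (j : ℕ) :
    prefixes a (j + 2) = extended a (.y j) ++ extended a (.x (j + 1)) := by
  rw [prefixes]; rfl

theorem mem_extended {a : ℕ → ℕ} {e : Edge} {p : List Edge} :
    p ∈ extended a e ↔ ∃ s ∈ continuing a e, p = s ++ [e] := by
  simp [extended, eq_comm]

theorem append_mem_extended {a : ℕ → ℕ} {e : Edge} {p : List Edge} :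
    p ++ [e] ∈ extended a e ↔ p ∈ continuing a e := by
  simp [extended]

theorem prefixes_congr {a a' : ℕ → ℕ} {j : ℕ} (h : ∀ k < j, a k = a' k) :
    prefixes a j = prefixes a' j := by
  induction j using Nat.strong_induction_on with
  | _ j ih =>
    match j with
    | 0 => rfl
    | 1 => rfl
    | j + 2 =>
      rw [prefixes, prefixes, ih j (by omega) (fun k hk => h k (by omega)),
        ih (j + 1) (by omega) (fun k hk => h k (by omega)), h j (by omega), h (j + 1) (by omega)]

theorem mem_prefixes_of_continuing {a : ℕ → ℕ} {k : ℕ} {p : List Edge}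
    (h : p ∈ continuing a (.x k) ∨ p ∈ continuing a (.y k)) : p ∈ prefixes a k := by
  rcases h with h | h
  · exact List.mem_of_mem_take h
  · exact List.mem_of_mem_drop h

theorem nodup_extended {a : ℕ → ℕ} {e : Edge} (h : (continuing a e).Nodup) :
    (extended a e).Nodup :=
  h.map (fun _ _ h => by simpa using h)

theorem disjoint_extended {a : ℕ → ℕ} {e f : Edge} (h : e ≠ f) :
    List.Disjoint (extended a e) (extended a f) := by
  intro p hp hp'
  obtain ⟨s, -, rfl⟩ := mem_extended.1 hp
  obtain ⟨t, -, ht⟩ := mem_extended.1 hp'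
  have := (List.append_inj' ht (by simp)).2
  simp_all

theorem nodup_continuing_of_prefixes {a : ℕ → ℕ} {k : ℕ} (h : (prefixes a k).Nodup) :
    (continuing a (.x k)).Nodup ∧ (continuing a (.y k)).Nodup :=
  ⟨h.sublist (List.take_sublist _ _), h.sublist (List.drop_sublist _ _)⟩

theorem nodup_prefixes (a : ℕ → ℕ) (j : ℕ) : (prefixes a j).Nodup := by
  induction j using Nat.strong_induction_on with
  | _ j ih =>
    match j with
    | 0 => simp [prefixes]
    | 1 => simp [prefixes]
    | j + 2 =>
      rw [prefixes_add_two]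
      exact List.Nodup.append
        (nodup_extended (nodup_continuing_of_prefixes (ih j (by omega))).2)
        (nodup_extended (nodup_continuing_of_prefixes (ih (j + 1) (by omega))).1)
        (disjoint_extended (by simp))

theorem nodup_continuing (a : ℕ → ℕ) (e : Edge) : (continuing a e).Nodup := by
  cases e with
  | x k => exact (nodup_continuing_of_prefixes (nodup_prefixes a k)).1
  | y k => exact (nodup_continuing_of_prefixes (nodup_prefixes a k)).2

theorem nodup_routes {n : ℕ} (hn : 3 ≤ n) (a : ℕ → ℕ) : (routes n a).Nodup := by
  refine List.Nodup.append (nodup_prefixes a n) (nodup_extended (nodup_continuing _ _)) ?_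
  obtain ⟨m, rfl⟩ : ∃ m, n = m + 2 := ⟨n - 2, by omega⟩
  rw [prefixes_add_two, List.disjoint_append_left]
  exact ⟨disjoint_extended (by simp), disjoint_extended (by simp)⟩

/-- Prefixes of listed paths are listed. -/
theorem mem_continuing_of_prefixes {a : ℕ → ℕ} {j : ℕ} {s q : List Edge} {e : Edge}
    (h : s ++ e :: q ∈ prefixes a j) : s ∈ continuing a e := by
  induction j using Nat.strong_induction_on generalizing q with
  | _ j ih =>
    match j with
    | 0 => simp [prefixes] at h
    | 1 => simp [prefixes] at h
    | j + 2 =>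
      have main : ∀ (f : Edge) (k : ℕ), k < j + 2 → (∀ t ∈ continuing a f, t ∈ prefixes a k) →
          s ++ e :: q ∈ extended a f → s ∈ continuing a e := by
        intro f k hk hf hm
        obtain ⟨t, ht, h'⟩ := mem_extended.1 hm
        -- Either `e` is the last edge, or the last edge is removed and the remaining path is listed
        -- at an earlier vertex.
        rcases List.eq_nil_or_concat q with rfl | ⟨q', g, rfl⟩
        · obtain ⟨rfl, h''⟩ := List.append_inj' h' (by simp)
          simp only [List.cons.injEq, and_true] at h''
          rwa [h'']
        · have h' : (s ++ e :: q') ++ [g] = t ++ [f] := by simpa using h'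
          obtain ⟨rfl, -⟩ := List.append_inj' h' (by simp)
          exact ih k hk (hf _ ht)
      rw [prefixes_add_two, List.mem_append] at h
      rcases h with h | h
      · exact main _ j (by omega) (fun t ht => mem_prefixes_of_continuing (.inr ht)) h
      · exact main _ (j + 1) (by omega) (fun t ht => mem_prefixes_of_continuing (.inl ht)) h

theorem mem_continuing_of_routes {n : ℕ} {a : ℕ → ℕ} {s q : List Edge} {e : Edge}
    (h : s ++ e :: q ∈ routes n a) : s ∈ continuing a e := by
  rcases List.mem_append.1 h with h | h
  · exact mem_continuing_of_prefixes h
  · obtain ⟨t, ht, h'⟩ := mem_extended.1 h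
    rcases List.eq_nil_or_concat q with rfl | ⟨q', g, rfl⟩
    · obtain ⟨rfl, h''⟩ := List.append_inj' h' (by simp)
      simp only [List.cons.injEq, and_true] at h''
      rwa [h'']
    · have h' : (s ++ e :: q') ++ [g] = t ++ [Edge.y (n - 1)] := by simpa using h'
      obtain ⟨rfl, -⟩ := List.append_inj' h' (by simp)
      exact mem_continuing_of_prefixes (mem_prefixes_of_continuing (.inr ht))

section Balanced

variable {n : ℕ} {a b : ℕ → ℕ}

theorem isPath_of_mem_prefixes (hn : 3 ≤ n) {j : ℕ} {p : List Edge} (h1 : 1 ≤ j) (hj : j ≤ n)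
    (hp : p ∈ prefixes a j) : IsPath n 1 j p := by
  induction j using Nat.strong_induction_on generalizing p with
  | _ j ih =>
    match j with
    | 0 => omega
    | 1 => simp [prefixes] at hp; simp [hp, IsPath]
    | j + 2 =>
      rw [prefixes_add_two, List.mem_append] at hp
      rcases hp with hp | hp
      · obtain ⟨s, hs, rfl⟩ := mem_extended.1 hp
        have hs := mem_prefixes_of_continuing (.inr hs)
        refine isPath_append_singleton.2 ⟨y_mem_edges.2 (by omega), ?_,
          by simp only [Edge.tgt]; omega⟩
        rcases Nat.eq_zero_or_pos j with rfl | h0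
        · simp [prefixes] at hs; simp [hs, IsPath, Edge.src]
        · have : (Edge.y j).src = j := by simp only [Edge.src]; omega
          rw [this]
          exact ih j (by omega) h0 (by omega) hs
      · obtain ⟨s, hs, rfl⟩ := mem_extended.1 hp
        have hs := mem_prefixes_of_continuing (.inl hs)
        exact isPath_append_singleton.2 ⟨x_mem_edges.2 (by omega),
          ih (j + 1) (by omega) (by omega) (by omega) hs, rfl⟩

theorem isRoute_of_mem_routes (hn : 3 ≤ n) {R : List Edge} (h : R ∈ routes n a) :
    IsRoute n R := by
  rcases List.mem_append.1 h with h | h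
  · exact isPath_of_mem_prefixes hn (by omega) le_rfl h
  · obtain ⟨s, hs, rfl⟩ := mem_extended.1 h
    have hs := mem_prefixes_of_continuing (.inr hs)
    have e1 : (Edge.y (n - 1)).src = n - 1 := by simp only [Edge.src]; omega
    refine isPath_append_singleton.2 ⟨y_mem_edges.2 (by omega), ?_, by simp only [Edge.tgt]; omega⟩
    rw [e1]
    exact isPath_of_mem_prefixes hn (by omega) (by omega) hs

theorem IsBalanced.length_prefixes (hb : IsBalanced n a b) {j : ℕ} (hj : j + 1 ≤ n) :
    (prefixes a j).length = a j + b j + 1 := by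
  induction j using Nat.strong_induction_on with
  | _ j ih =>
    match j with
    | 0 => simp [prefixes, hb.a_zero, hb.b_zero]
    | 1 => simp [prefixes, hb.a_one, hb.b_one]
    | j + 2 =>
      have h1 := ih j (by omega) (by omega)
      have h2 := ih (j + 1) (by omega) (by omega)
      have := hb.step j (by omega)
      simp only [prefixes, List.length_append, List.length_map, List.length_drop,
        List.length_take, h1, h2]
      omega

theorem IsBalanced.length_continuing_x (hb : IsBalanced n a b) {j : ℕ} (hj : j + 1 ≤ n) :
    (continuing a (.x j)).length = a j + 1 := by
  simp [continuing, hb.length_prefixes hj]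

theorem IsBalanced.length_continuing_y (hb : IsBalanced n a b) {j : ℕ} (hj : j + 1 ≤ n) :
    (continuing a (.y j)).length = b j + 1 := by
  simp [continuing, hb.length_prefixes hj]; omega

/-! ### Order of the listed prefixes and their extension to routes -/

theorem pairwise_prefixes {j : ℕ} (hj : j + 1 ≤ n) :
    (prefixes a j).Pairwise (PrefixLT n) := by
  induction j using Nat.strong_induction_on with
  | _ j ih =>
    match j with
    | 0 => simp [prefixes]
    | 1 => simp [prefixes]
    | j + 2 =>
      rw [prefixes_add_two, List.pairwise_append]
      refine ⟨?_, ?_, ?_⟩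
      · exact List.Pairwise.map _ (fun _ _ h => h.append _)
          ((ih j (by omega) (by omega)).sublist (List.drop_sublist _ _))
      · exact List.Pairwise.map _ (fun _ _ h => h.append _)
          ((ih (j + 1) (by omega) (by omega)).sublist (List.take_sublist _ _))
      · intro p hp q hq
        obtain ⟨s, -, rfl⟩ := mem_extended.1 hp
        obtain ⟨t, -, rfl⟩ := mem_extended.1 hq
        exact ⟨j + 2, s, t, [], _, _, rfl, rfl, ⟨by omega, by omega⟩, rfl, rfl⟩

theorem mem_continuing_or {k : ℕ} {p : List Edge} (h : p ∈ prefixes a k) :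
    p ∈ continuing a (.x k) ∨ p ∈ continuing a (.y k) := by
  rw [← List.take_append_drop (a k) (prefixes a k), List.mem_append] at h
  refine h.imp (fun h => ?_) id
  exact (List.take_subset_take_left _ (Nat.le_succ _)) h

/-- Every listed prefix extends to a listed route. -/
theorem exists_append_mem_routes {k : ℕ} {p : List Edge} (h1 : 1 ≤ k)
    (hk : k ≤ n) (h : p ∈ prefixes a k) : ∃ q, p ++ q ∈ routes n a := by
  induction hd : n - k using Nat.strong_induction_on generalizing k p with
  | _ d ih =>
    rcases eq_or_lt_of_le hk with rfl | hlt
    · exact ⟨[], by simp [routes, h]⟩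
    · obtain ⟨m, rfl⟩ : ∃ m, k = m + 1 := ⟨k - 1, by omega⟩
      rcases mem_continuing_or h with h | h
      · obtain ⟨q, hq⟩ := ih (n - (m + 1 + 1)) (by omega) (k := m + 1 + 1) (p := p ++ [.x (m + 1)])
          (by omega) hlt
          (by rw [prefixes_add_two]; exact List.mem_append_right _ (append_mem_extended.2 h)) rfl
        exact ⟨_, by simpa using hq⟩
      · rcases eq_or_lt_of_le (Nat.succ_le_of_lt hlt) with heq | hlt'
        · refine ⟨[.y (m + 1)], List.mem_append_right _ ?_⟩
          have : n - 1 = m + 1 := by omega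
          rw [this]
          exact append_mem_extended.2 h
        · obtain ⟨q, hq⟩ := ih (n - (m + 1 + 2)) (by omega) (k := m + 1 + 2)
            (p := p ++ [.y (m + 1)]) (by omega) hlt'
            (by rw [prefixes_add_two]; exact List.mem_append_left _ (append_mem_extended.2 h)) rfl
          exact ⟨_, by simpa using hq⟩

theorem exists_append_cons_mem_routes (hn : 3 ≤ n) {e : Edge} (he : e ∈ edges n) {p : List Edge}
    (h : p ∈ continuing a e) : ∃ q, p ++ e :: q ∈ routes n a := by
  have h := append_mem_extended.2 h
  have main : ∀ k, 1 ≤ k → k ≤ n → p ++ [e] ∈ prefixes a k → ∃ q, p ++ e :: q ∈ routes n a := by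
    intro k h1 hk hm
    obtain ⟨q, hq⟩ := exists_append_mem_routes h1 hk hm
    exact ⟨q, by simpa using hq⟩
  cases e with
  | x k =>
    obtain ⟨h1, h2⟩ := x_mem_edges.1 he
    obtain ⟨m, rfl⟩ : ∃ m, k = m + 1 := ⟨k - 1, by omega⟩
    exact main (m + 2) (by omega) (by omega)
      (by rw [prefixes_add_two]; exact List.mem_append_right _ h)
  | y k =>
    have hk := y_mem_edges.1 he
    by_cases hk' : k + 2 ≤ n
    · exact main (k + 2) (by omega) hk'
        (by rw [prefixes_add_two]; exact List.mem_append_left _ h)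
    · obtain rfl : k = n - 1 := by omega
      exact ⟨[], List.mem_append_right _ h⟩

end Balanced

/-! ### The clique of a flow -/

section Clique

variable {n : ℕ} {a b : ℕ → ℕ}

/-- The prefix at `k` that continues along both outgoing edges. -/
theorem IsBalanced.exists_pivot (hb : IsBalanced n a b) {k : ℕ} (hk : k + 1 ≤ n) :
    ∃ A p B, prefixes a k = A ++ p :: B ∧ A.length = a k ∧
      continuing a (.x k) = A ++ [p] ∧ continuing a (.y k) = p :: B := by
  have hl := hb.length_prefixes hk
  have hlt : a k < (prefixes a k).length := by omega
  refine ⟨(prefixes a k).take (a k), (prefixes a k)[a k], (prefixes a k).drop (a k + 1),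
    ?_, by simp; omega, ?_, ?_⟩
  · simp
  · simp [continuing]
  · simp [continuing]

/-- A prefix that fails to continue along an outgoing edge is separated from it by the pivot. -/
theorem IsBalanced.pivot_separates (hb : IsBalanced n a b) {k : ℕ} (hk : k + 1 ≤ n) :
    ∃ p, p ∈ continuing a (.x k) ∧ p ∈ continuing a (.y k) ∧
      (∀ s ∈ prefixes a k, s ∉ continuing a (.x k) → PrefixLT n p s) ∧
      (∀ s ∈ prefixes a k, s ∉ continuing a (.y k) → PrefixLT n s p) := by
  obtain ⟨A, p, B, hL, -, hx, hy⟩ := hb.exists_pivot hk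
  have hpw := pairwise_prefixes (a := a) hk
  rw [hL, List.pairwise_append, List.pairwise_cons] at hpw
  obtain ⟨-, ⟨h₁, -⟩, h₂⟩ := hpw
  refine ⟨p, by simp [hx], by simp [hy], fun s hs hs' => h₁ s ?_, fun s hs hs' => h₂ s ?_ p ?_⟩
  · simp only [hL, hx, List.mem_append, List.mem_cons] at hs hs'; tauto
  · simp only [hL, hy, List.mem_append, List.mem_cons] at hs hs'; tauto
  · simp

/-- The slack continuations end, and the nonslack ones begin, with the pivot. -/
theorem IsBalanced.not_prefixLT (hb : IsBalanced n a b) {k : ℕ} (hk : k + 1 ≤ n)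
    {p q : List Edge} (hp : p ∈ continuing a (.x k)) (hq : q ∈ continuing a (.y k)) :
    ¬ PrefixLT n q p := by
  obtain ⟨A, c, B, hL, -, hx, hy⟩ := hb.exists_pivot hk
  have hpw := pairwise_prefixes (a := a) hk
  rw [hL, List.pairwise_append, List.pairwise_cons] at hpw
  obtain ⟨-, ⟨h₁, -⟩, h₂⟩ := hpw
  rw [hx, List.mem_append, List.mem_singleton] at hp
  rw [hy] at hq
  intro hlt
  rcases hp with hp | rfl
  · exact hlt.asymm (h₂ p hp q hq)
  · rcases List.mem_cons.1 hq with rfl | hq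
    · exact hlt.asymm hlt
    · exact hlt.asymm (h₁ q hq)

/-- A crossing at `i` can be carried along the common part `S` of the suffixes to the vertex `k`
where they diverge. There the earlier prefix takes `y k` and the later one `x k`, against the order
of the lists. -/
theorem IsBalanced.not_cross (hb : IsBalanced n a b) {R R' : List Edge}
    (hR : R ∈ routes n a) (hR' : R' ∈ routes n a) : ¬ Cross n R R' := by
  rintro ⟨i, P, Q, P', Q', -, -, -, -, -, rfl, rfl, hP, k, S, A, A', e, e', rfl, rfl, hk, rfl, rfl⟩
  rw [← List.append_assoc] at hR hR'
  exact hb.not_prefixLT (by have := hk.1; have := hk.2; omega) (mem_continuing_of_routes hR')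
    (mem_continuing_of_routes hR) (hP.append S)

theorem IsBalanced.isClique (hb : IsBalanced n a b) (hn : 3 ≤ n) :
    IsClique n {R | R ∈ routes n a} :=
  ⟨fun _ hR => isRoute_of_mem_routes hn hR,
    fun _ hR _ hR' => ⟨hb.not_cross hR hR', hb.not_cross hR' hR⟩⟩

theorem src_x {k : ℕ} : (Edge.x k).src = k := rfl

theorem IsInner.src_y {k : ℕ} (hk : IsInner n k) : (Edge.y k).src = k := by
  have := hk.1; simp only [Edge.src]; omega

theorem IsInner.x_mem {k : ℕ} (hk : IsInner n k) : Edge.x k ∈ edges n :=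
  x_mem_edges.2 ⟨by have := hk.1; omega, hk.2⟩

theorem IsInner.y_mem {k : ℕ} (hk : IsInner n k) : Edge.y k ∈ edges n :=
  y_mem_edges.2 (by have := hk.1; have := hk.2; omega)

/-- A set of routes consists of listed routes if at each inner vertex listed prefixes continue
only as the lists prescribe. -/
theorem subset_routes_of_local (hb : IsBalanced n a b) (hn : 3 ≤ n) {C : Set (List Edge)}
    (hC : ∀ R ∈ C, IsRoute n R)
    (H : ∀ k, IsInner n k → (∀ P e, (P, e) ∈ treeEdges n C k → P ∈ prefixes a k) →
      ∀ P e, (P, e) ∈ treeEdges n C k → P ∈ continuing a e) :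
    C ⊆ {R | R ∈ routes n a} := by
  have step : ∀ k, k ≤ n → ∀ P Q, P ++ Q ∈ C → IsPath n 1 k P →
      (k < n → P ∈ prefixes a k) ∧ (k = n → P ∈ routes n a) := by
    intro k
    induction k using Nat.strong_induction_on with
    | _ k ih =>
    intro hk P Q hR hP
    rcases List.eq_nil_or_concat P with rfl | ⟨s, e, rfl⟩
    · simp only [IsPath] at hP
      subst hP
      exact ⟨fun _ => by simp [prefixes], fun h => by omega⟩
    · rw [List.concat_eq_append] at *
      obtain ⟨he, hs, htgt⟩ := isPath_append_singleton.1 hP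
      have hlt := Edge.src_lt_tgt hn he
      have hse : s ∈ continuing a e := by
        -- At vertex `1` only the empty prefix exists, and it is listed as continuing along `x 1`,
        -- `y 0` and `y 1`; local information is needed only at inner vertices.
        rcases Nat.lt_or_ge e.src 2 with h2 | h2
        · have h1 : e.src = 1 := by have := Edge.one_le_src he; omega
          rw [h1] at hs
          obtain rfl := hs.eq_nil hn
          cases e with
          | x k =>
            obtain rfl : k = 1 := h1
            simp [continuing, prefixes]
          | y k =>
            have : k = 0 ∨ k = 1 := by simp only [Edge.src] at h1; omega
            rcases this with rfl | rfl
            · simp [continuing, prefixes, hb.a_zero]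
            · simp [continuing, prefixes, hb.a_one]
        · refine H e.src ⟨h2, by omega⟩ ?_ s e ⟨he, rfl, _, hR, Q, by simp⟩
          rintro P' e' ⟨he', hsrc, R, hR', Q', rfl⟩
          have := (hC _ hR').isPath_src.2.1
          simp only at hsrc this
          rw [hsrc] at this
          exact (ih e.src (by omega) (by omega) P' _ hR' this).1 (by omega)
      cases e with
      | x m =>
        have := x_mem_edges.1 he
        have hm : s ++ [Edge.x m] ∈ prefixes a k := by
          obtain ⟨j, rfl⟩ : ∃ j, m = j + 1 := ⟨m - 1, by omega⟩
          simp only [Edge.tgt] at htgt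
          subst htgt
          rw [prefixes_add_two]
          exact List.mem_append_right _ (append_mem_extended.2 hse)
        refine ⟨fun _ => hm, ?_⟩
        rintro rfl
        exact List.mem_append_left _ hm
      | y m =>
        have := y_mem_edges.1 he
        have hm : k = m + 2 → s ++ [Edge.y m] ∈ prefixes a k := by
          rintro rfl
          rw [prefixes_add_two]
          exact List.mem_append_left _ (append_mem_extended.2 hse)
        simp only [Edge.tgt] at htgt
        refine ⟨fun hkn => hm (by omega), fun hkn => ?_⟩
        by_cases hm2 : m + 2 ≤ n
        · have := hm (by omega)
          rw [hkn] at this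
          exact List.mem_append_left _ this
        · obtain rfl : m = n - 1 := by omega
          exact List.mem_append_right _ (append_mem_extended.2 hse)
  intro R hR
  exact (step n le_rfl R [] (by simpa using hR) (hC R hR)).2 rfl

theorem cross_of_prefixLT {P P' Q Q' : List Edge} {k : ℕ} (hk : IsInner n k)
    (hR : IsRoute n (P ++ Edge.y k :: Q)) (hR' : IsRoute n (P' ++ Edge.x k :: Q'))
    (h : PrefixLT n P P') : Cross n (P ++ Edge.y k :: Q) (P' ++ Edge.x k :: Q') := by
  obtain ⟨-, hP, hQ⟩ := hR.isPath_src
  obtain ⟨-, hP', hQ'⟩ := hR'.isPath_src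
  rw [hk.src_y] at hP hQ
  exact ⟨k, P, _, P', _, hk, hP, hQ, hP', hQ', rfl, rfl, h,
    k, [], Q', Q, _, _, rfl, rfl, hk, rfl, rfl⟩

/-- If a listed prefix took an edge not prescribed for it, the pivot would lie strictly on the other
side, and a listed route through the pivot along the other outgoing edge would cross. -/
theorem IsBalanced.isMaxClique (hb : IsBalanced n a b) (hn : 3 ≤ n) :
    IsMaxClique n {R | R ∈ routes n a} := by
  refine ⟨hb.isClique hn, fun C hC hsub => ?_⟩
  refine subset_routes_of_local hb hn hC.1 fun k hk hP P e hPe => ?_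
  have hPk := hP P e hPe
  obtain ⟨p, hpx, hpy, hpx', hpy'⟩ := hb.pivot_separates (k := k) (by have := hk.1; have := hk.2; omega)
  obtain ⟨he, hsrc, R, hR, Q, rfl⟩ := hPe
  simp only at he hsrc hR
  by_contra hcon
  cases e with
  | x m =>
    obtain rfl : m = k := hsrc
    obtain ⟨q, hq⟩ := exists_append_cons_mem_routes hn hk.y_mem hpy
    exact (hC.2 _ (hsub hq) _ hR).1 (cross_of_prefixLT hk (hC.1 _ (hsub hq)) (hC.1 _ hR)
      (hpx' P hPk hcon))
  | y m =>
    obtain rfl : m = k := by have := hk.1; simp only [Edge.src] at hsrc; omega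
    obtain ⟨q, hq⟩ := exists_append_cons_mem_routes hn hk.x_mem hpx
    exact (hC.2 _ hR _ (hsub hq)).1 (cross_of_prefixLT hk (hC.1 _ hR) (hC.1 _ (hsub hq))
      (hpy' P hPk hcon))

/-! ### The flow of the listed clique and uniqueness of the clique -/

theorem treeEdges_routes (hn : 3 ≤ n) {e : Edge} (he : e ∈ edges n) :
    {P | (P, e) ∈ treeEdges n {R | R ∈ routes n a} e.src} = {P | P ∈ continuing a e} := by
  ext P
  constructor
  · rintro ⟨-, -, R, hR, Q, rfl⟩
    exact mem_continuing_of_routes hR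
  · intro hP
    obtain ⟨q, hq⟩ := exists_append_cons_mem_routes hn he hP
    exact ⟨he, rfl, _, hq, q, rfl⟩

theorem ncard_setOf_mem {α : Type*} {l : List α} (h : l.Nodup) :
    {x | x ∈ l}.ncard = l.length := by
  classical
  rw [← List.toFinset_card_of_nodup h, ← Set.ncard_coe_finset]
  congr 1
  ext; simp

/-- Two sets of entries of a list of `a + b + 1` elements with `a + 1` and `b + 1` elements, the
first weakly before the second, lie in the first `a + 1` and the last `b + 1` entries. -/
theorem mem_take_and_mem_drop {α : Type*} {r : α → α → Prop} {l : List α} (hr : l.Pairwise r)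
    {a b : ℕ} (hl : l.length = a + b + 1) {S T : Set α}
    (hS : ∀ s ∈ S, s ∈ l) (hT : ∀ t ∈ T, t ∈ l) (hSc : S.ncard = a + 1) (hTc : T.ncard = b + 1)
    (hST : ∀ s ∈ S, ∀ t ∈ T, ¬ r t s) :
    (∀ s ∈ S, s ∈ l.take (a + 1)) ∧ (∀ t ∈ T, t ∈ l.drop a) := by
  classical
  have idx : ∀ U : Set α, (∀ u ∈ U, u ∈ l) → ∃ I : Finset ℕ, I.card = U.ncard ∧
      (∀ i ∈ I, ∃ h : i < l.length, l[i] ∈ U) ∧ ∀ u ∈ U, ∃ i ∈ I, l[i]? = some u := by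
    intro U hU
    have hfin : U.Finite := (List.finite_toSet l).subset hU
    refine ⟨hfin.toFinset.image (fun u => l.idxOf u), ?_, ?_, ?_⟩
    · rw [Finset.card_image_of_injOn, Set.ncard_eq_toFinset_card U hfin]
      intro u hu v hv huv
      exact (List.idxOf_inj (hU u (by simpa using hu))).1 huv
    · intro i hi
      obtain ⟨u, hu, rfl⟩ := Finset.mem_image.1 hi
      have hu : u ∈ U := by simpa using hu
      exact ⟨List.idxOf_lt_length_of_mem (hU u hu), by simpa using hu⟩
    · intro u hu
      exact ⟨_, Finset.mem_image_of_mem _ (by simpa using hu), by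
        rw [List.getElem?_eq_getElem (List.idxOf_lt_length_of_mem (hU u hu))]; simp⟩
  obtain ⟨I, hIc, hI, hSI⟩ := idx S hS
  obtain ⟨J, hJc, hJ, hTJ⟩ := idx T hT
  have hIJ : ∀ i ∈ I, ∀ j ∈ J, i ≤ j := by
    intro i hi j hj
    obtain ⟨hil, his⟩ := hI i hi
    obtain ⟨hjl, hjt⟩ := hJ j hj
    by_contra hlt
    exact hST _ his _ hjt (List.pairwise_iff_getElem.1 hr j i hjl hil (by omega))
  have hIne : I.Nonempty := Finset.card_pos.1 (by omega)
  have hJne : J.Nonempty := Finset.card_pos.1 (by omega)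
  -- The `a + 1` positions in `I` fit into `[0, min J]` and the `b + 1` positions in `J` into `[max
  -- I, a + b]`. Hence `max I ≤ a ≤ min J`.
  have h₁ : I.card ≤ (Finset.range (J.min' hJne + 1)).card := Finset.card_le_card fun i hi =>
    Finset.mem_range.2 (Nat.lt_succ_of_le (hIJ i hi _ (Finset.min'_mem J hJne)))
  have h₂ : J.card ≤ (Finset.Ico (I.max' hIne) (a + b + 1)).card := Finset.card_le_card
    fun j hj => Finset.mem_Ico.2 ⟨hIJ _ (Finset.max'_mem I hIne) j hj, by
      obtain ⟨h, -⟩ := hJ j hj; omega⟩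
  simp only [Finset.card_range, Nat.card_Ico] at h₁ h₂
  constructor
  · intro s hs
    obtain ⟨i, hi, his⟩ := hSI s hs
    have := Finset.le_max' I i hi
    exact List.mem_iff_getElem?.2 ⟨i, by rw [List.getElem?_take_of_lt (by omega), his]⟩
  · intro t ht
    obtain ⟨j, hj, hjt⟩ := hTJ t ht
    have := Finset.min'_le J j hj
    exact List.mem_iff_getElem?.2 ⟨j - a, by
      rw [List.getElem?_drop, Nat.add_sub_cancel' (by omega), hjt]⟩

/-- The integer flow with values `a` and `b`. -/
structure IsFlowOf (n : ℕ) (a b : ℕ → ℕ) (φ : Edge → ℤ) : Prop where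
  balanced : IsBalanced n a b
  eq_x : ∀ k, φ (.x k) = a k
  eq_y : ∀ k, φ (.y k) = b k
  eq_zero : ∀ e, e ∉ edges n → φ e = 0

theorem IsFlowOf.flowOf_routes {φ : Edge → ℤ} (h : IsFlowOf n a b φ) (hn : 3 ≤ n) :
    flowOf n {R | R ∈ routes n a} = φ := by
  funext e
  have hb := h.balanced
  unfold flowOf
  split_ifs with he
  · obtain ⟨he, h2⟩ := he
    rw [treeEdges_routes hn he, ncard_setOf_mem (nodup_continuing a e)]
    cases e with
    | x k =>
      have := x_mem_edges.1 he
      rw [hb.length_continuing_x (by omega), h.eq_x]; simp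
    | y k =>
      have := y_mem_edges.1 he
      rw [hb.length_continuing_y (by omega), h.eq_y]; simp
  · by_cases hm : e ∈ edges n
    · have h1 : e.src = 1 := by have := Edge.one_le_src hm; simp only [hm, true_and] at he; omega
      cases e with
      | x k =>
        obtain rfl : k = 1 := h1
        rw [h.eq_x, hb.a_one]; rfl
      | y k =>
        have : k = 0 ∨ k = 1 := by simp only [Edge.src] at h1; omega
        rcases this with rfl | rfl
        · rw [h.eq_y, hb.b_zero]; rfl
        · rw [h.eq_y, hb.b_one]; rfl
    · exact (h.eq_zero e hm).symm

/-- Once the prefixes at `k` are known to be listed, the flow gives the number of continuations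
along each edge and coherence their relative order, so `mem_take_and_mem_drop` fixes their range.
Thus `C` consists of listed routes, and its maximality gives equality. -/
theorem IsFlowOf.eq_routes {φ : Edge → ℤ} (h : IsFlowOf n a b φ) (hn : 3 ≤ n)
    {C : Set (List Edge)} (hC : IsMaxClique n C) (hφ : flowOf n C = φ) :
    C = {R | R ∈ routes n a} := by
  have hb := h.balanced
  have hsub : C ⊆ {R | R ∈ routes n a} := by
    refine subset_routes_of_local hb hn hC.1.1 fun k hk hP => ?_
    have hkn : k + 1 ≤ n := by have := hk.1; have := hk.2; omega
    have hx : {P | (P, Edge.x k) ∈ treeEdges n C k}.ncard = a k + 1 := by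
      have := congrFun hφ (.x k)
      rw [flowOf, if_pos ⟨hk.x_mem, hk.1⟩, h.eq_x] at this
      simp only [src_x] at this
      omega
    have hy : {P | (P, Edge.y k) ∈ treeEdges n C k}.ncard = b k + 1 := by
      have := congrFun hφ (.y k)
      rw [flowOf, if_pos ⟨hk.y_mem, by rw [hk.src_y]; exact hk.1⟩, h.eq_y] at this
      simp only [hk.src_y] at this
      omega
    obtain ⟨h₁, h₂⟩ := mem_take_and_mem_drop (pairwise_prefixes hkn)
      (hb.length_prefixes hkn) (fun P => hP P _) (fun P => hP P _) hx hy (by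
        rintro p ⟨-, -, R, hR, Q, rfl⟩ q ⟨-, -, R', hR', Q', rfl⟩ hlt
        exact (hC.1.2 _ hR' _ hR).1
          (cross_of_prefixLT hk (hC.1.1 _ hR') (hC.1.1 _ hR) hlt))
    intro P e hPe
    cases e with
    | x m =>
      obtain rfl : m = k := hPe.2.1
      exact h₁ P hPe
    | y m =>
      obtain rfl : m = k := by have := hPe.2.1; have := hk.1; simp only [Edge.src] at *; omega
      exact h₂ P hPe
  exact hsub.antisymm (hC.2 (hb.isClique hn) hsub)

theorem IsFlowOf.corresponds_iff {φ : Edge → ℤ} (h : IsFlowOf n a b φ) (hn : 3 ≤ n)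
    (hmax : IsMaxClique n {R | R ∈ routes n a}) (Θ : triangulation n) :
    Corresponds n Θ φ ↔ Θ = ⟨simplexOf {R | R ∈ routes n a}, _, hmax, rfl⟩ := by
  constructor
  · rintro ⟨C, hC, hΘ, hφ⟩
    rw [h.eq_routes hn hC hφ] at hΘ
    exact Subtype.ext hΘ
  · rintro rfl
    exact ⟨_, hmax, rfl, h.flowOf_routes hn⟩

end Clique

/-! ### Simplices and their facets -/

/-- All points of `S` are vertices of the unit cube, which contains the hull: a coordinate 0 or 1
inside an open segment of the cube is constant on that segment. -/
theorem extremePoints_convexHull_of_zero_one {ι : Type*} {S : Set (ι → ℝ)}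
    (hS : ∀ f ∈ S, ∀ i, f i = 0 ∨ f i = 1) : (convexHull ℝ S).extremePoints ℝ = S := by
  refine extremePoints_convexHull_subset.antisymm fun f hf => ?_
  have hcube : convexHull ℝ S ⊆ Set.Icc 0 1 := by
    refine convexHull_min (fun g hg => ?_) (convex_Icc 0 1)
    refine ⟨fun i => ?_, fun i => ?_⟩ <;> rcases hS g hg i with h | h <;> simp [h]
  refine ⟨subset_convexHull ℝ S hf, fun g hg h hh hseg => ?_⟩
  have hg := hcube hg
  have hh := hcube hh
  obtain ⟨s, t, hs, ht, hst, rfl⟩ := hseg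
  funext i
  have g0 := hg.1 i
  have g1 := hg.2 i
  have h0 := hh.1 i
  have h1 := hh.2 i
  have hf := hS _ hf i
  simp only [Pi.add_apply, Pi.smul_apply, smul_eq_mul, Pi.zero_apply, Pi.one_apply] at *
  rcases hf with hf | hf
  · have : s * g i = 0 := by nlinarith [mul_nonneg hs.le g0, mul_nonneg ht.le h0]
    rw [hf]
    simpa [hs.ne'] using this
  · have : s * (1 - g i) = 0 := by
      nlinarith [mul_nonneg hs.le (sub_nonneg.2 g1), mul_nonneg ht.le (sub_nonneg.2 h1)]
    rw [hf]
    have : 1 - g i = 0 := by simpa [hs.ne'] using this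
    linarith

theorem extremePoints_convexHull_routeVec (C : Set (List Edge)) :
    (convexHull ℝ (routeVec '' C)).extremePoints ℝ = routeVec '' C := by
  refine extremePoints_convexHull_of_zero_one ?_
  rintro _ ⟨R, -, rfl⟩ e
  simp only [routeVec]
  split_ifs <;> simp

theorem routeVec_injOn {n : ℕ} (hn : 3 ≤ n) : Set.InjOn routeVec {R | IsRoute n R} := by
  intro R hR R' hR' h
  refine IsRoute.eq_of_mem_iff hn hR hR' fun e => ?_
  have := congrFun h e
  simp only [routeVec] at this
  split_ifs at this <;> simp_all

theorem isFacet_simplexOf {n : ℕ} (hn : 3 ≤ n) {C : Set (List Edge)}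
    (hC : ∀ R ∈ C, IsRoute n R) {F : Set (Edge → ℝ)} :
    IsFacet F (simplexOf C) ↔ ∃ R ∈ C, F = simplexOf (C \ {R}) := by
  unfold IsFacet simplexOf
  rw [extremePoints_convexHull_routeVec]
  have key : ∀ R ∈ C, routeVec '' (C \ {R}) = routeVec '' C \ {routeVec R} := by
    intro R hR
    rw [((routeVec_injOn hn).mono hC).image_sdiff_subset (by simpa using hR), Set.image_singleton]
  constructor
  · rintro ⟨_, ⟨R, hR, rfl⟩, rfl⟩
    exact ⟨R, hR, by rw [key R hR]⟩
  · rintro ⟨R, hR, rfl⟩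
    exact ⟨_, ⟨R, hR, rfl⟩, by rw [key R hR]⟩

theorem simplexOf_inj {n : ℕ} (hn : 3 ≤ n) {C C' : Set (List Edge)}
    (hC : ∀ R ∈ C, IsRoute n R) (hC' : ∀ R ∈ C', IsRoute n R) :
    simplexOf C = simplexOf C' ↔ C = C' := by
  refine ⟨fun h => ?_, fun h => by rw [h]⟩
  have := extremePoints_convexHull_routeVec C
  have h' := extremePoints_convexHull_routeVec C'
  unfold simplexOf at h
  rw [h, h'] at this
  exact ((routeVec_injOn hn).image_eq_image_iff hC hC').1 this.symm

/-- Two simplices of the triangulation are adjacent if and only if their cliques differ in exactly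
one route. -/
theorem dualGraph_adj_iff {n : ℕ} (hn : 3 ≤ n) {Δ Δ' : triangulation n} {C C' : Set (List Edge)}
    (hC : ∀ R ∈ C, IsRoute n R) (hC' : ∀ R ∈ C', IsRoute n R) (h : Δ.1 = simplexOf C)
    (h' : Δ'.1 = simplexOf C') :
    (dualGraph n).Adj Δ Δ' ↔ C ≠ C' ∧ ∃ R ∈ C, ∃ R' ∈ C', C \ {R} = C' \ {R'} := by
  change (Δ ≠ Δ' ∧ ∃ F, IsFacet F Δ.1 ∧ IsFacet F Δ'.1) ↔ _
  rw [h, h', ne_eq, Subtype.ext_iff, h, h', simplexOf_inj hn hC hC']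
  refine and_congr_right fun _ => ?_
  constructor
  · rintro ⟨F, hF, hF'⟩
    obtain ⟨R, hR, rfl⟩ := (isFacet_simplexOf hn hC).1 hF
    obtain ⟨R', hR', h⟩ := (isFacet_simplexOf hn hC').1 hF'
    exact ⟨R, hR, R', hR', (simplexOf_inj hn (fun _ h => hC _ h.1) (fun _ h => hC' _ h.1)).1 h⟩
  · rintro ⟨R, hR, R', hR', h⟩
    exact ⟨simplexOf (C \ {R}), (isFacet_simplexOf hn hC).2 ⟨R, hR, rfl⟩,
      (isFacet_simplexOf hn hC').2 ⟨R', hR', by rw [h]⟩⟩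

/-! ### Integer flows -/

/-- Nothing enters vertex `1` and its net flow is 0, so nonnegativity kills the flow on `x 1`, `y
0`, `y 1`. Conservation at the inner vertex `j + 2` is the balance recursion. -/
theorem isFlowOf_of_mem_integerFlows {n : ℕ} (hn : 3 ≤ n) {φ : Edge → ℤ}
    (h : φ ∈ integerFlows n) :
    IsFlowOf n (fun k => (φ (.x k)).toNat) (fun k => (φ (.y k)).toNat) φ := by
  obtain ⟨h0, hz, hc⟩ := h
  have hx : φ (.x 1) = 0 ∧ φ (.y 0) = 0 ∧ φ (.y 1) = 0 := by
    have h1 := hc 1 le_rfl (by omega)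
    have e1 : (edges n).filter (fun e => e.tgt n = 1) = ∅ := by
      ext e
      simp only [Finset.mem_filter, Finset.notMem_empty, iff_false, not_and]
      intro he
      have := Edge.src_lt_tgt hn he
      have := Edge.one_le_src he
      omega
    have e2 : (edges n).filter (fun e => e.src = 1) = {.x 1, .y 0, .y 1} := by
      ext e
      cases e with
      | x k =>
        rw [Finset.mem_filter, x_mem_edges]
        simp only [Edge.src, Finset.mem_insert,
          Finset.mem_singleton, Edge.x.injEq, reduceCtorEq, or_false]
        omega
      | y k =>
        rw [Finset.mem_filter, y_mem_edges]
        simp only [Edge.src, Finset.mem_insert,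
          Finset.mem_singleton, Edge.y.injEq, reduceCtorEq, false_or]
        omega
    rw [e1, e2, Finset.sum_insert (by simp), Finset.sum_insert (by simp)] at h1
    simp [netFlow] at h1
    have := h0 (.x 1)
    have := h0 (.y 0)
    have := h0 (.y 1)
    omega
  refine ⟨⟨?_, ?_, ?_, ?_, fun j hj => ?_⟩, fun k => ?_, fun k => ?_, hz⟩
  · simp [hz (.x 0) (by simp [x_mem_edges])]
  · simp [hx.1]
  · simp [hx.2.1]
  · simp [hx.2.2]
  · have h1 := hc (j + 2) (by omega) (by omega)
    have e1 : (edges n).filter (fun e => e.tgt n = j + 2) = {.y j, .x (j + 1)} := by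
      ext e
      cases e with
      | x k =>
        rw [Finset.mem_filter, x_mem_edges]
        simp only [Edge.tgt, Finset.mem_insert,
          Finset.mem_singleton, Edge.x.injEq, reduceCtorEq, false_or]
        omega
      | y k =>
        rw [Finset.mem_filter, y_mem_edges]
        simp only [Edge.tgt, Finset.mem_insert,
          Finset.mem_singleton, Edge.y.injEq, reduceCtorEq, or_false]
        omega
    have e2 : (edges n).filter (fun e => e.src = j + 2) = {.x (j + 2), .y (j + 2)} := by
      ext e
      cases e with
      | x k =>
        rw [Finset.mem_filter, x_mem_edges]
        simp only [Edge.src, Finset.mem_insert,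
          Finset.mem_singleton, Edge.x.injEq, reduceCtorEq, or_false]
        omega
      | y k =>
        rw [Finset.mem_filter, y_mem_edges]
        simp only [Edge.src, Finset.mem_insert,
          Finset.mem_singleton, Edge.y.injEq, reduceCtorEq, false_or]
        omega
    rw [e1, e2, Finset.sum_pair (by simp), Finset.sum_pair (by simp), netFlow,
      if_neg (by omega), if_neg (by omega)] at h1
    have := h0 (.x (j + 1))
    have := h0 (.x (j + 2))
    have := h0 (.y j)
    have := h0 (.y (j + 2))
    omega
  · exact (Int.toNat_of_nonneg (h0 _)).symm
  · exact (Int.toNat_of_nonneg (h0 _)).symm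

/-- The values on slack edges after the move at `i`. -/
def moveX (n i : ℕ) (a : ℕ → ℕ) (k : ℕ) : ℕ :=
  if k = i then a k - 1 else if k = i + 2 ∧ k + 1 ≤ n then a k + 1 else a k

/-- The values on nonslack edges after the move at `i`. -/
def moveY (n i : ℕ) (b : ℕ → ℕ) (k : ℕ) : ℕ :=
  if k = i + 1 ∧ k + 1 ≤ n then b k - 1 else if k = i then b k + 1 else b k

theorem IsFlowOf.move {n i : ℕ} {a b : ℕ → ℕ} {φ : Edge → ℤ} (h : IsFlowOf n a b φ)
    (hi : IsInner n i) (happ : MoveApplies n i φ) :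
    IsFlowOf n (moveX n i a) (moveY n i b) (move n i φ) := by
  obtain ⟨h1, h2⟩ := hi
  obtain ⟨hx, hy⟩ := happ
  rw [y_mem_edges, h.eq_y] at hy
  rw [h.eq_x] at hx
  obtain ⟨⟨a0, a1, b0, b1, hs⟩, ex, ey, ez⟩ := h
  have zx : ∀ k, ¬ (1 ≤ k ∧ k ≤ n - 1) → a k = 0 := fun k hk => by
    have := ez (.x k) (by rwa [x_mem_edges]); rw [ex] at this; omega
  have zy : ∀ k, ¬ (k < n) → b k = 0 := fun k hk => by
    have := ez (.y k) (by rwa [y_mem_edges]); rw [ey] at this; omega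
  have zy1 := zy (i + 1)
  refine ⟨⟨?_, ?_, ?_, ?_, fun j hj => ?_⟩, fun k => ?_, fun k => ?_, fun e he => ?_⟩
  · unfold moveX; split_ifs <;> first | omega | grind
  · unfold moveX; split_ifs <;> omega
  · unfold moveY; split_ifs <;> omega
  · unfold moveY; split_ifs <;> omega
  -- Only the vertices `i`, …, `i + 3` meet edges changed by the move, and at each of them the two
  -- changes cancel.
  · have hs := hs j hj
    unfold moveX moveY
    by_cases e1 : i = j
    · subst e1; simp; split_ifs <;> omega
    by_cases e2 : i = j + 1
    · subst e2; simp; split_ifs <;> first | omega | grind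
    by_cases e3 : i = j + 2
    · subst e3; simp; split_ifs <;> omega
    · split_ifs <;> first | omega | grind
  · simp only [ZigZag.move, x_mem_edges, Edge.x.injEq, reduceCtorEq, or_false, ex, moveX]
    split_ifs <;> first | omega | grind
  · simp only [ZigZag.move, y_mem_edges, Edge.y.injEq, reduceCtorEq, false_or, ey, moveY]
    split_ifs <;> first | omega | grind
  · simp only [ZigZag.move, he, if_false]
    exact ez e he

/-! ### Lists that differ in one entry -/

/-- Two lists differ exactly in the entry of index `m`. -/
def DifferAt {α : Type*} (m : ℕ) (l l' : List α) : Prop :=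
  ∃ A q q' B, l = A ++ q :: B ∧ l' = A ++ q' :: B ∧ q ≠ q' ∧ A.length = m

/-- Two lists agree up to order and the exchange of one entry. -/
def IsExchange {α : Type*} (l l' : List α) : Prop :=
  ∃ q q' T, l.Perm (q :: T) ∧ l'.Perm (q' :: T)

section Lists

variable {α β : Type*} {l l' : List α} {m k : ℕ}

theorem DifferAt.isExchange (h : DifferAt m l l') : IsExchange l l' := by
  obtain ⟨A, q, q', B, rfl, rfl, -, -⟩ := h
  exact ⟨q, q', A ++ B, List.perm_middle, List.perm_middle⟩

theorem DifferAt.append_right (h : DifferAt m l l') (C : List α) :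
    DifferAt m (l ++ C) (l' ++ C) := by
  obtain ⟨A, q, q', B, rfl, rfl, hne, hm⟩ := h
  exact ⟨A, q, q', B ++ C, by simp, by simp, hne, hm⟩

theorem DifferAt.append_left (h : DifferAt m l l') (C : List α) :
    DifferAt (C.length + m) (C ++ l) (C ++ l') := by
  obtain ⟨A, q, q', B, rfl, rfl, hne, rfl⟩ := h
  exact ⟨C ++ A, q, q', B, by simp, by simp, hne, by simp⟩

theorem DifferAt.map (h : DifferAt m l l') {f : α → β} (hf : f.Injective) :
    DifferAt m (l.map f) (l'.map f) := by
  obtain ⟨A, q, q', B, rfl, rfl, hne, rfl⟩ := h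
  exact ⟨A.map f, f q, f q', B.map f, by simp, by simp, hf.ne hne, by simp⟩

theorem DifferAt.take_eq (h : DifferAt m l l') (hk : k ≤ m) : l.take k = l'.take k := by
  obtain ⟨A, q, q', B, rfl, rfl, hne, rfl⟩ := h
  rw [List.take_append_of_le_length hk, List.take_append_of_le_length hk]

theorem DifferAt.drop_eq (h : DifferAt m l l') (hk : m < k) : l.drop k = l'.drop k := by
  obtain ⟨A, q, q', B, rfl, rfl, hne, rfl⟩ := h
  obtain ⟨d, rfl⟩ := Nat.exists_eq_add_of_lt hk
  simp [List.drop_append, Nat.add_assoc]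

theorem DifferAt.take (h : DifferAt m l l') (hk : m < k) : DifferAt m (l.take k) (l'.take k) := by
  obtain ⟨A, q, q', B, rfl, rfl, hne, rfl⟩ := h
  obtain ⟨d, rfl⟩ := Nat.exists_eq_add_of_lt hk
  refine ⟨A, q, q', B.take d, ?_, ?_, hne, rfl⟩ <;>
    rw [Nat.add_assoc, List.take_length_add_append, List.take_succ_cons]

theorem DifferAt.drop (h : DifferAt m l l') (hk : k ≤ m) :
    DifferAt (m - k) (l.drop k) (l'.drop k) := by
  obtain ⟨A, q, q', B, rfl, rfl, hne, rfl⟩ := h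
  exact ⟨A.drop k, q, q', B, by rw [List.drop_append_of_le_length hk],
    by rw [List.drop_append_of_le_length hk], hne, by simp⟩

end Lists

theorem append_singleton_injective (e : Edge) :
    Function.Injective (fun p : List Edge => p ++ [e]) :=
  fun _ _ h => by simpa using h

/-! ### Propagation of a difference through the lists of prefixes -/

section Propagation

variable {n : ℕ} {a b a' : ℕ → ℕ}

theorem extended_congr {j : ℕ} (h : prefixes a j = prefixes a' j) (ha : a j = a' j) :
    extended a (.x j) = extended a' (.x j) ∧ extended a (.y j) = extended a' (.y j) := by
  simp [extended, continuing, h, ha]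

/-- Negative offset: the differing entry lies before the pivot, so it continues along the slack edge
only. -/
theorem prefixes_succ_differAt {k m : ℕ} (hY : extended a (.y k) = extended a' (.y k))
    (hL : DifferAt m (prefixes a (k + 1)) (prefixes a' (k + 1))) (ha : a (k + 1) = a' (k + 1))
    (hm : m < a (k + 1)) :
    extended a (.y (k + 1)) = extended a' (.y (k + 1)) ∧
      DifferAt ((extended a (.y k)).length + m) (prefixes a (k + 2)) (prefixes a' (k + 2)) := by
  constructor
  · simp only [extended, continuing, ← ha, hL.drop_eq hm]
  · rw [prefixes_add_two, prefixes_add_two, ← hY]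
    refine DifferAt.append_left ?_ _
    simp only [extended, continuing, ← ha]
    exact (hL.take (by omega)).map (append_singleton_injective _)

/-- Positive offset: the differing entry lies after the pivot, so the next vertex sees no change and
the difference reappears two vertices later. -/
theorem extended_y_differAt {k m : ℕ} (hY : extended a (.y k) = extended a' (.y k))
    (hL : DifferAt m (prefixes a (k + 1)) (prefixes a' (k + 1))) (ha : a (k + 1) = a' (k + 1))
    (hm : a (k + 1) < m) :
    prefixes a (k + 2) = prefixes a' (k + 2) ∧
      DifferAt (m - a (k + 1)) (extended a (.y (k + 1))) (extended a' (.y (k + 1))) := by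
  constructor
  · rw [prefixes_add_two, prefixes_add_two, ← hY]
    simp only [extended, continuing, ← ha, hL.take_eq hm]
  · simp only [extended, continuing, ← ha]
    exact (hL.drop hm.le).map (append_singleton_injective _)

/-- Offset zero: the replaced entry is the pivot. It occurs only once in its list, so the exchange
removes it altogether. -/
theorem exists_pivot_notMem {j : ℕ} (hL : DifferAt (a j) (prefixes a j) (prefixes a' j)) :
    ∃ q, q ∈ continuing a (.x j) ∧ q ∈ continuing a (.y j) ∧ q ∉ prefixes a' j := by
  obtain ⟨A, q, q', B, hl, hl', hne, hA⟩ := hL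
  have hnd := nodup_prefixes a j
  refine ⟨q, ?_, ?_, ?_⟩
  · rw [continuing, hl, ← hA, List.take_length_add_append]; simp
  · rw [continuing, hl, ← hA, List.drop_left]; simp
  · rw [hl, List.nodup_middle, List.nodup_cons] at hnd
    rw [hl']
    simp only [List.mem_append, List.mem_cons, not_or] at hnd ⊢
    exact ⟨hnd.1.1, hne, hnd.1.2⟩

/-- If the prefixes at a vertex differ in one entry with offset `z` from the pivot, the offsets
starting with `z` decide whether the cliques differ in one route or a pivot is replaced. -/
theorem IsBalanced.isExchange_or_pivot {φ : Edge → ℤ} (hb : IsBalanced n a b)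
    (hx : ∀ k, φ (.x k) = a k) (hy : ∀ k, φ (.y k) = b k) (d : ℕ) :
    ∀ (k m : ℕ) (z : ℤ), k + 1 + d = n → (m : ℤ) = z + a (k + 1) →
      (∀ l, k < l → a l = a' l) → extended a (.y k) = extended a' (.y k) →
      DifferAt m (prefixes a (k + 1)) (prefixes a' (k + 1)) →
      (some 0 ∉ offsetsFrom φ d (k + 1) z → IsExchange (routes n a) (routes n a')) ∧
      (some 0 ∈ offsetsFrom φ d (k + 1) z → ∃ j q, 1 ≤ j ∧ j + 1 ≤ n ∧
        q ∈ continuing a (.x j) ∧ q ∈ continuing a (.y j) ∧ q ∉ prefixes a' j) := by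
  induction d using Nat.strong_induction_on with
  | _ d ih =>
  intro k m z hn hm ha hY hL
  have hak := ha (k + 1) (by omega)
  have pivot : z = 0 → d ≠ 0 → ∃ j q, 1 ≤ j ∧ j + 1 ≤ n ∧
      q ∈ continuing a (.x j) ∧ q ∈ continuing a (.y j) ∧ q ∉ prefixes a' j := by
    rintro rfl hd
    obtain rfl : m = a (k + 1) := by omega
    obtain ⟨q, hq⟩ := exists_pivot_notMem hL
    exact ⟨k + 1, q, by omega, by omega, hq⟩
  match d with
  | 0 =>
    refine ⟨fun _ => ?_, fun h => by simp [offsetsFrom] at h⟩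
    obtain rfl : n = k + 1 := by omega
    -- At vertex `n` the list contains all routes except those ending with `y (n - 1)`, which are
    -- unaffected by `hY`.
    simp only [routes, Nat.add_sub_cancel, ← hY]
    exact (hL.append_right _).isExchange
  | 1 =>
    obtain rfl : n = k + 2 := by omega
    simp only [offsetsFrom, List.mem_singleton, Option.some.injEq]
    refine ⟨fun hz => ?_, fun hz => pivot hz.symm (by omega)⟩
    rw [routes, routes, show k + 2 - 1 = k + 1 by omega]
    rcases lt_or_gt_of_ne (Ne.symm hz) with hz | hz
    · obtain ⟨hY', hL'⟩ := prefixes_succ_differAt hY hL hak (by omega)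
      rw [← hY']
      exact (hL'.append_right _).isExchange
    · obtain ⟨hL', hY'⟩ := extended_y_differAt hY hL hak (by omega)
      rw [← hL']
      exact (hY'.append_left _).isExchange
  | d + 2 =>
    rw [offsetsFrom]
    by_cases hz : z = 0
    · rw [if_pos hz]
      exact ⟨fun h => by simp at h, fun _ => pivot hz (by omega)⟩
    rw [if_neg hz]
    have hz' : ¬ (0 = z) := fun h => hz h.symm
    by_cases hneg : z < 0
    · rw [if_pos hneg]
      obtain ⟨hY', hL'⟩ := prefixes_succ_differAt hY hL hak (by omega)
      simp only [List.mem_cons, Option.some.injEq, hz', false_or]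
      refine ih (d + 1) (by omega) (k + 1) _ _ (by omega) ?_ (fun l hl => ha l (by omega)) hY' hL'
      -- The new index is `b k + 1 + m`; by the balance at `k + 2`, its distance from `a (k + 2)` is
      -- `z + b (k + 2)`.
      have := hb.step k (by omega)
      rw [extended, List.length_map, hb.length_continuing_y (by omega), hy]
      rw [show k + 1 + 1 = k + 2 from rfl]
      push_cast
      omega
    · rw [if_neg hneg]
      obtain ⟨hL', hY'⟩ := extended_y_differAt hY hL hak (by omega)
      obtain ⟨hX₂, hY₂⟩ := extended_congr hL' (ha (k + 2) (by omega))
      simp only [List.mem_cons, Option.some.injEq, hz', reduceCtorEq, false_or]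
      refine ih d (by omega) (k + 2) (m - a (k + 1)) _ (by omega) ?_ (fun l hl => ha l (by omega))
        hY₂ ?_
      -- Dropping the first `a (k + 1)` entries turns the index `m` into `z`, and nothing precedes
      -- the extensions by `y (k + 1)` in the list at `k + 3`.
      · rw [hx, show k + 1 + 2 = k + 2 + 1 from rfl]; omega
      · rw [prefixes_add_two, prefixes_add_two, ← hX₂]
        exact hY'.append_right _

/-- The effect of the move at `i` on the clique of a flow. -/
theorem IsFlowOf.isExchange_or_pivot {φ : Edge → ℤ} {i : ℕ} (h : IsFlowOf n a b φ)
    (hi : IsInner n i) (happ : MoveApplies n i φ) :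
    (some 0 ∉ offsets n i φ → IsExchange (routes n a) (routes n (moveX n i a))) ∧
    (some 0 ∈ offsets n i φ → ∃ j q, 1 ≤ j ∧ j + 1 ≤ n ∧
        q ∈ continuing a (.x j) ∧ q ∈ continuing a (.y j) ∧ q ∉ prefixes (moveX n i a) j) := by
  have hb := h.balanced
  have hb' := (h.move hi happ).balanced
  obtain ⟨h2, hin⟩ := hi
  obtain ⟨hx, hy⟩ := happ
  rw [y_mem_edges, h.eq_y] at hy
  rw [h.eq_x] at hx
  obtain ⟨c, rfl⟩ : ∃ c, i = c + 1 := ⟨i - 1, by omega⟩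
  generalize ha' : moveX n (c + 1) a = a' at *
  generalize hb'' : moveY n (c + 1) b = b' at *
  have hai : a (c + 1) = a' (c + 1) + 1 := by rw [← ha', moveX, if_pos rfl]; omega
  have hai2 : c + 3 < n → a' (c + 3) = a (c + 3) + 1 := fun hlt => by
    rw [← ha', moveX, if_neg (by omega), if_pos (by omega)]
  have ha : ∀ l, l ≠ c + 1 → l ≠ c + 3 → a l = a' l := fun l h1 h2 => by
    rw [← ha', moveX, if_neg h1, if_neg (by omega)]
  have hL : ∀ l, l ≤ c + 1 → prefixes a l = prefixes a' l := fun l hl =>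
    prefixes_congr fun k hk => ha k (by omega) (by omega)
  obtain ⟨A, q, B, hLi, hA, hxi, hyi⟩ := hb.exists_pivot (k := c + 1) (by omega)
  obtain ⟨A', q', B', hLi', hA', hxi', hyi'⟩ := hb'.exists_pivot (k := c + 1) (by omega)
  -- The list at `i` is unchanged and `a i` drops by one, so the new pivot `q'` directly precedes
  -- the old pivot `q`.
  obtain ⟨rfl, rfl⟩ : A = A' ++ [q'] ∧ B' = q :: B := by
    rw [← hL _ le_rfl, hLi] at hLi'
    have : A ++ q :: B = (A' ++ [q']) ++ B' := by simpa using hLi'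
    obtain ⟨h1, h2⟩ := List.append_inj this (by simp; omega)
    exact ⟨h1, h2.symm⟩
  have hYc : extended a (.y c) = extended a' (.y c) :=
    (extended_congr (hL c (by omega)) (ha c (by omega) (by omega))).2
  have hXi : extended a (.x (c + 1)) = extended a' (.x (c + 1)) ++ [q ++ [.x (c + 1)]] := by
    simp [extended, hxi, hxi']
  have hYi : extended a' (.y (c + 1)) = (q' ++ [.y (c + 1)]) :: extended a (.y (c + 1)) := by
    simp [extended, hyi, hyi']
  have hL2 : prefixes a (c + 2) = prefixes a' (c + 2) ++ [q ++ [.x (c + 1)]] := by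
    rw [prefixes_add_two, prefixes_add_two, hYc, hXi, List.append_assoc]
  rcases eq_or_lt_of_le (show c + 2 ≤ n by omega) with rfl | hlt
  · have hoff : offsets (c + 2) (c + 1) φ = [] := by simp [offsets, offsetsFrom]
    simp only [hoff, List.not_mem_nil, not_false_eq_true, forall_const, false_imp_iff, and_true]
    refine ⟨q ++ [.x (c + 1)], q' ++ [.y (c + 1)], prefixes a' (c + 2) ++ extended a (.y (c + 1)),
      ?_, ?_⟩
    · rw [routes, show c + 2 - 1 = c + 1 by omega, hL2, List.append_assoc]
      exact List.perm_middle
    · rw [routes, show c + 2 - 1 = c + 1 by omega, hYi]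
      exact List.perm_middle
  have hby : 0 < (b (c + 2) : ℤ) := hy (by omega)
  have ha2 := ha (c + 2) (by omega) (by omega)
  have hlen := hb'.length_prefixes (j := c + 2) (by omega)
  have hmb : b' (c + 2) + 1 = b (c + 2) := by
    rw [← hb'', moveY, if_pos (by omega)]; omega
  have hlen2 := congrArg List.length hL2
  rw [hb.length_prefixes (by omega)] at hlen2
  simp only [List.length_append, List.length_singleton] at hlen2
  -- The lost prefix is the last one at `i + 1`; since `b (i + 1) > 0` it is not the pivot, so only
  -- the extensions by `y (i + 1)` lose an entry.
  have hXi1 : extended a (.x (c + 2)) = extended a' (.x (c + 2)) := by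
    simp only [extended, continuing, hL2, ← ha2]
    rw [List.take_append_of_le_length]
    omega
  have hYi1 : extended a (.y (c + 2)) =
      extended a' (.y (c + 2)) ++ [q ++ [.x (c + 1)] ++ [.y (c + 2)]] := by
    simp only [extended, continuing, hL2, ← ha2]
    rw [List.drop_append_of_le_length (by omega)]
    simp
  have hL3 : prefixes a' (c + 3) = (q' ++ [.y (c + 1)]) :: prefixes a (c + 3) := by
    rw [prefixes_add_two, prefixes_add_two, hXi1, hYi, List.cons_append]
  rcases eq_or_lt_of_le (show c + 3 ≤ n by omega) with rfl | hlt'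
  · have hoff : some 0 ∉ offsets (c + 3) (c + 1) φ := by
      rw [offsets, show c + 3 - 1 - (c + 1) = 1 by omega]
      simp only [offsetsFrom, List.mem_singleton, Option.some.injEq, h.eq_y]
      omega
    refine ⟨fun _ => ?_, fun h => absurd h hoff⟩
    refine ⟨q ++ [.x (c + 1)] ++ [.y (c + 2)], q' ++ [.y (c + 1)],
      prefixes a (c + 3) ++ extended a' (.y (c + 2)), ?_, ?_⟩
    · rw [routes, show c + 3 - 1 = c + 2 by omega, hYi1, ← List.append_assoc]
      exact List.perm_append_singleton _ _
    · rw [routes, show c + 3 - 1 = c + 2 by omega, hL3, List.cons_append]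
  have ha3 := hai2 hlt'
  -- The gained prefix comes first at `i + 2`, and the increase of `a (i + 2)` by one absorbs it:
  -- the nonslack continuations remain the same.
  have hXi2 : extended a' (.x (c + 3)) =
      (q' ++ [.y (c + 1)] ++ [.x (c + 3)]) :: extended a (.x (c + 3)) := by
    simp [extended, continuing, hL3, ha3]
  have hYi2 : extended a (.y (c + 3)) = extended a' (.y (c + 3)) := by
    simp [extended, continuing, hL3, ha3]
  have hdiff : DifferAt (extended a' (.y (c + 2))).length (prefixes a (c + 4))
      (prefixes a' (c + 4)) := by
    refine ⟨extended a' (.y (c + 2)), q ++ [.x (c + 1)] ++ [.y (c + 2)],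
      q' ++ [.y (c + 1)] ++ [.x (c + 3)], extended a (.x (c + 3)), ?_, ?_, ?_, rfl⟩
    · rw [prefixes_add_two, hYi1, List.append_assoc]; rfl
    · rw [prefixes_add_two, hXi2]
    · intro he
      have := (List.append_inj' he rfl).2
      simp at this
  obtain ⟨d, rfl⟩ : ∃ d, n = c + 4 + d := ⟨n - (c + 4), by omega⟩
  -- The first offset `b (i + 1)` is positive, so the recursion skips `i + 2`; the next offset
  -- belongs to `i + 3`, where the lists first differ by an exchange.
  have hoff : offsets (c + 4 + d) (c + 1) φ = some (φ (.y (c + 2))) :: none ::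
      offsetsFrom φ d (c + 4) (φ (.y (c + 2)) - φ (.x (c + 4))) := by
    rw [offsets, show c + 4 + d - 1 - (c + 1) = d + 2 by omega, offsetsFrom, if_neg, if_neg] <;>
    rw [h.eq_y] <;> omega
  have hne : ¬ (0 = (b (c + 2) : ℤ)) := by omega
  rw [hoff]
  simp only [List.mem_cons, Option.some.injEq, h.eq_y, hne, reduceCtorEq, false_or]
  refine hb.isExchange_or_pivot h.eq_x h.eq_y d (c + 3) _ _ (by omega) ?_
    (fun l hl => ha l (by omega) (by omega)) hYi2 hdiff
  rw [extended, List.length_map, hb'.length_continuing_y (by omega), h.eq_x, show c + 3 + 1 = c + 4 from rfl]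
  omega

end Propagation

end ZigZag

/-! ### Adjacency of the two simplices -/

theorem theorem1 (n i : ℕ) (hi : ZigZag.IsInner n i)
    (φ : ZigZag.Edge → ℤ) (hφ : φ ∈ ZigZag.integerFlows n) (happ : ZigZag.MoveApplies n i φ) :
    ∃ Δ Δ' : ZigZag.triangulation n,
      (∀ Θ, ZigZag.Corresponds n Θ φ ↔ Θ = Δ) ∧
      (∀ Θ, ZigZag.Corresponds n Θ (ZigZag.move n i φ) ↔ Θ = Δ') ∧
      ((ZigZag.dualGraph n).Adj Δ Δ' ↔ some 0 ∉ ZigZag.offsets n i φ) := by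
  have hn : 3 ≤ n := by have := hi.1; have := hi.2; omega
  have h := ZigZag.isFlowOf_of_mem_integerFlows hn hφ
  generalize (fun k => (φ (.x k)).toNat) = a at h
  generalize (fun k => (φ (.y k)).toNat) = b at h
  have h' := h.move hi happ
  have hmax := h.balanced.isMaxClique hn
  have hmax' := h'.balanced.isMaxClique hn
  refine ⟨⟨_, _, hmax, rfl⟩, ⟨_, _, hmax', rfl⟩, h.corresponds_iff hn hmax,
    h'.corresponds_iff hn hmax', ?_⟩
  rw [ZigZag.dualGraph_adj_iff hn hmax.1.1 hmax'.1.1 rfl rfl]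
  obtain ⟨hex, hpiv⟩ := h.isExchange_or_pivot hi happ
  constructor
  · rintro ⟨-, R, hR, R', hR', hsd⟩ h0
    obtain ⟨j, q, hj, hjn, hqx, hqy, hq⟩ := hpiv h0
    -- Every route of the old clique other than `R` survives the move. Routes through the lost pivot
    -- `q` do not, so both of its continuations would have to be `R`.
    have key : ∀ e, (e = .x j ∨ e = .y j) → q ∈ ZigZag.continuing a e → ∃ s, R = q ++ e :: s := by
      intro e he hqe
      obtain ⟨s, hs⟩ := ZigZag.exists_append_cons_mem_routes hn (e := e) (by
        rcases he with rfl | rfl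
        · exact ZigZag.x_mem_edges.2 (by omega)
        · exact ZigZag.y_mem_edges.2 (by omega)) hqe
      refine ⟨s, ?_⟩
      by_contra hne
      have hm : q ++ e :: s ∈ {R | R ∈ ZigZag.routes n a} \ {R} := ⟨hs, fun h => hne h.symm⟩
      rw [hsd] at hm
      have := ZigZag.mem_continuing_of_routes hm.1
      rcases he with rfl | rfl
      · exact hq (ZigZag.mem_prefixes_of_continuing (.inl this))
      · exact hq (ZigZag.mem_prefixes_of_continuing (.inr this))
    obtain ⟨s, hs⟩ := key _ (.inl rfl) hqx
    obtain ⟨t, ht⟩ := key _ (.inr rfl) hqy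
    rw [hs] at ht
    simp at ht
  · intro h0
    obtain ⟨R, R', T, hT, hT'⟩ := hex h0
    refine ⟨fun heq => ?_, R, hT.mem_iff.2 (by simp), R', hT'.mem_iff.2 (by simp), ?_⟩
    -- The cliques are different because their flows differ on `x i`.
    · have := h'.flowOf_routes hn
      rw [← heq, h.flowOf_routes hn] at this
      have := congrFun this (.x i)
      rw [h'.eq_x, h.eq_x, ZigZag.moveX, if_pos rfl] at this
      have hpos := happ.1
      rw [h.eq_x] at hpos
      omega
    · have hnd := hT.nodup_iff.1 (ZigZag.nodup_routes hn a)
      have hnd' := hT'.nodup_iff.1 (ZigZag.nodup_routes hn _)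
      rw [List.nodup_cons] at hnd hnd'
      ext S
      simp only [Set.mem_sdiff, Set.mem_ofPred_eq, hT.mem_iff, hT'.mem_iff, List.mem_cons,
        Set.mem_singleton_iff]
      constructor
      · rintro ⟨hS | hS, hne⟩
        · exact absurd hS hne
        · exact ⟨.inr hS, fun h => hnd'.1 (h ▸ hS)⟩
      · rintro ⟨hS | hS, hne⟩
        · exact absurd hS hne
        · exact ⟨.inr hS, fun h => hnd.1 (h ▸ hS)⟩
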